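/- Let $k$ be a field. A commutative graded $k$-algebra $R=\bigoplus_{i\ge 0}R_i$ is called standard if it is generated as a $k$-algebra by finitely many elements of $R_1$. A polynomial $f(x)\in\mathbb{Q}[x]$ is called a Hilbert polynomial if there is a standard graded $k$-algebra $R$ such that $\dim_k R_i=f(i)$ for all sufficiently large integers $i$. Theorem. Let $d$ be a positive integer, let $a_0,\ldots,a_{d-1}$ be integers, and let $N=\min\{a_0,\ldots,a_{d-1}\}$. (1) If $N\ge -2$, then for every integer $n\ge 5d+3$ the polynomial $nx^d+a_{d-1}x^{d-1}+\cdots+a_0$ is a Hilbert polynomial. (2) If $N<-2$, then for every integer $n\ge -10d\lfloor N/5\rfloor+3$ the polynomial $nx^d+a_{d-1}x^{d-1}+\cdots+a_0$ is a Hilbert polynomial. -/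

import Mathlib

open Polynomial

universe u

/-- A commutative `ℕ`-graded `k`-algebra `R = ⨁ 𝒜 i` is *standard* if it is generated as a
`k`-algebra by finitely many elements of its component of degree one. -/
def IsStandardGraded (k : Type u) {R : Type u} [Field k] [CommRing R] [Algebra k R]
    (𝒜 : ℕ → Submodule k R) [GradedAlgebra 𝒜] : Prop :=
  ∃ s : Finset R, (∀ r ∈ s, r ∈ 𝒜 1) ∧ Algebra.adjoin k (s : Set R) = ⊤

/-- The Hilbert function `i ↦ dim_k R_i`. (All the components of a standard graded algebra
are finite-dimensional.) -/
noncomputable def hilbertFunction (k : Type u) {R : Type u} [Field k] [CommRing R] [Algebra k R]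
    (𝒜 : ℕ → Submodule k R) (i : ℕ) : ℕ :=
  Module.finrank k (𝒜 i)

/-- `f ∈ ℚ[x]` is a *Hilbert polynomial* over `k` if there is a standard graded commutative
`k`-algebra whose Hilbert function agrees with `f` in all large degrees. -/
def IsHilbertPolynomial (k : Type u) [Field k] (f : ℚ[X]) : Prop :=
  ∃ (R : Type u) (_ : CommRing R) (_ : Algebra k R) (𝒜 : ℕ → Submodule k R)
    (_ : GradedAlgebra 𝒜), IsStandardGraded k 𝒜 ∧
      ∃ m : ℕ, 0 < m ∧ ∀ i : ℕ, m ≤ i → (hilbertFunction k 𝒜 i : ℚ) = f.eval (i : ℚ)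

/-! If `1 ∈ S` is a finite subset of a commutative monoid, the monoid algebra of the pairs `(i, g)`
with `g ∈ S ^ i` is standard graded with Hilbert function `|S ^ i|`. So it suffices to realise
polynomials as power growths, which are closed under products and sums. The set `{0, 1, e}` in `ℕ`
yields `P_e = e(x+1) - e(e-1)/2`. Subtracting `(x+1)^(d-1) P_n` removes the leading term `n x^d`
and, since `n(n-1)/2` is large compared with `n d`, lowers no remaining coefficient, while the new
leading coefficient is at least `n`. Induction on `d` then applies with the same lower bound `N`. -/

open scoped Pointwise in
/-- `f` describes the growth, for large `i`, of the number of elements of the power `S ^ i` of a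
finite subset `S ∋ 1` of a commutative monoid. -/
def IsPowerGrowthPolynomial (f : ℚ[X]) : Prop :=
  ∃ (G : Type) (_ : CommMonoid G) (S : Set G), S.Finite ∧ 1 ∈ S ∧
    ∃ m : ℕ, ∀ i : ℕ, m ≤ i → ((S ^ i).ncard : ℚ) = f.eval (i : ℚ)

/-! ### From power growth to graded algebras -/

section Algebra

open scoped Pointwise

/-- The submonoid of `ℕ × G` consisting of the pairs `(i, g)` with `g ∈ S ^ i`. -/
def powerMonoid {G : Type*} [CommMonoid G] (S : Set G) : AddSubmonoid (ℕ × Additive G) where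
  carrier := {p | p.2.toMul ∈ S ^ p.1}
  zero_mem' := by simp
  add_mem' {a b} ha hb := by
    change a.2.toMul * b.2.toMul ∈ S ^ (a.1 + b.1)
    rw [pow_add]
    exact Set.mul_mem_mul ha hb

/-- The degree `(i, g) ↦ i` on `powerMonoid S`. -/
def powerMonoidDegree {G : Type*} [CommMonoid G] (S : Set G) : powerMonoid S →+ ℕ :=
  (AddMonoidHom.fst ℕ (Additive G)).comp (powerMonoid S).subtype

/-- The elements of degree `i` of `powerMonoid S` are the elements of `S ^ i`. -/
def powerMonoidFiberEquiv {G : Type*} [CommMonoid G] (S : Set G) (i : ℕ) :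
    (powerMonoidDegree S ⁻¹' {i} : Set (powerMonoid S)) ≃ (S ^ i : Set G) where
  toFun p := ⟨p.1.1.2.toMul, by
    have h : p.1.1.2.toMul ∈ S ^ p.1.1.1 := p.1.2
    rwa [show p.1.1.1 = i from p.2] at h⟩
  invFun g := ⟨⟨(i, Additive.ofMul g.1), g.2⟩, rfl⟩
  left_inv p := by
    have h2 : p.1.1.1 = i := p.2
    apply Subtype.ext
    apply Subtype.ext
    exact Prod.ext h2.symm rfl
  right_inv g := rfl

theorem finrank_gradeBy (k : Type*) [Field k] {M ι : Type*} (f : M → ι) (i : ι) :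
    Module.finrank k (AddMonoidAlgebra.gradeBy k f i) = (f ⁻¹' {i}).ncard := by
  have e : AddMonoidAlgebra.gradeBy k f i ≃ₗ[k] ((f ⁻¹' {i} : Set M) →₀ k) :=
    (AddMonoidAlgebra.supportedEquivFinsupp (R := k) (S := k) (f ⁻¹' {i}))
  rw [e.finrank_eq]
  by_cases h : Finite (f ⁻¹' {i} : Set M)
  · have := Fintype.ofFinite (f ⁻¹' {i} : Set M)
    rw [Module.finrank_finsupp_self, ← Nat.card_coe_set_eq, Nat.card_eq_fintype_card]
  · have hi : Infinite (f ⁻¹' {i} : Set M) := not_finite_iff_infinite.1 h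
    -- For an infinite fibre both sides take the default value 0.
    rw [Set.Infinite.ncard (Set.infinite_coe_iff.1 hi)]
    apply Module.finrank_of_not_finite
    intro hf
    exact h (Module.Finite.finite_basis (Finsupp.basisSingleOne (R := k)))

theorem isStandardGraded_powerMonoid (k : Type u) [Field k] {G : Type} [CommMonoid G] {S : Set G}
    (hS : S.Finite) :
    IsStandardGraded k (AddMonoidAlgebra.gradeBy k (powerMonoidDegree S)) := by
  classical
  let T : Set (AddMonoidAlgebra k (powerMonoid S)) :=
    (fun a => AddMonoidAlgebra.single a 1) '' (powerMonoidDegree S ⁻¹' {1})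
  have hT : T.Finite := by
    apply Set.Finite.image
    have : Finite (S ^ 1 : Set G) := by rw [pow_one]; exact hS
    exact Set.finite_coe_iff.1 (Finite.of_equiv _ (powerMonoidFiberEquiv S 1).symm)
  refine ⟨hT.toFinset, ?_, ?_⟩
  · intro r hr
    obtain ⟨a, ha, rfl⟩ := hT.mem_toFinset.1 hr
    have := AddMonoidAlgebra.single_mem_gradeBy (powerMonoidDegree S) a (1 : k)
    rwa [show powerMonoidDegree S a = 1 from ha] at this
  · rw [hT.coe_toFinset]
    have key : ∀ (i : ℕ) (g : G) (hg : g ∈ S ^ i),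
        (AddMonoidAlgebra.single (⟨(i, Additive.ofMul g), hg⟩ : powerMonoid S) (1 : k)) ∈
          Algebra.adjoin k T := by
      intro i
      induction i with
      | zero =>
        intro g hg
        have h1 : g = 1 := by simpa using hg
        subst h1
        exact one_mem _
      | succ i ih =>
        intro g hg
        have hg' := hg
        rw [pow_succ] at hg'
        obtain ⟨x, hx, y, hy, rfl⟩ := Set.mem_mul.1 hg'
        have hy1 : y ∈ S ^ 1 := by simpa using hy
        have h2 : (AddMonoidAlgebra.single
            (⟨(1, Additive.ofMul y), hy1⟩ : powerMonoid S) (1 : k)) ∈ Algebra.adjoin k T :=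
          Algebra.subset_adjoin ⟨_, rfl, rfl⟩
        have h3 := mul_mem (ih x hx) h2
        rw [AddMonoidAlgebra.single_mul_single, mul_one] at h3
        exact h3
    rw [eq_top_iff]
    rintro x -
    induction x using AddMonoidAlgebra.induction_linear with
    | zero => exact zero_mem _
    | add x y hx hy => exact add_mem hx hy
    | single a r =>
      have h := Subalgebra.smul_mem _ (key a.1.1 a.1.2.toMul a.2) r
      simpa using h

theorem IsPowerGrowthPolynomial.isHilbertPolynomial (k : Type u) [Field k] {f : ℚ[X]}
    (hf : IsPowerGrowthPolynomial f) : IsHilbertPolynomial k f := by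
  obtain ⟨G, _, S, hS, -, m, hm⟩ := hf
  refine ⟨AddMonoidAlgebra k (powerMonoid S), inferInstance, inferInstance,
    AddMonoidAlgebra.gradeBy k (powerMonoidDegree S), inferInstance,
    isStandardGraded_powerMonoid k hS, m + 1, Nat.succ_pos m, fun i hi => ?_⟩
  rw [← hm i (by omega), hilbertFunction, finrank_gradeBy, ← Nat.card_coe_set_eq,
    Nat.card_congr (powerMonoidFiberEquiv S i), Nat.card_coe_set_eq]

end Algebra

/-! ### Closure properties and basic examples of power growth -/

section Growth

open scoped Pointwise

theorem IsPowerGrowthPolynomial.mul {f g : ℚ[X]} (hf : IsPowerGrowthPolynomial f)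
    (hg : IsPowerGrowthPolynomial g) : IsPowerGrowthPolynomial (f * g) := by
  obtain ⟨G, _, S, hS, hS1, m, hm⟩ := hf
  obtain ⟨H, _, T, hT, hT1, l, hl⟩ := hg
  refine ⟨G × H, inferInstance, S ×ˢ T, hS.prod hT, ⟨hS1, hT1⟩, max m l, fun i hi => ?_⟩
  rw [Set.prod_pow, Set.ncard_prod, eval_mul, Nat.cast_mul, hm i (le_of_max_le_left hi),
    hl i (le_of_max_le_right hi)]

/-- The sets `S` and `T`, glued so that the product of an element of `S` and an element of `T` is
the latter. -/
def gluedSet {G H : Type*} [Monoid G] [Monoid H] (S : Set G) (T : Set H) :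
    Set (WithZero G × H) :=
  (fun s : G => ((s : WithZero G), (1 : H))) '' S ∪ (fun t : H => ((0 : WithZero G), t)) '' T

/-- As `1 ∈ T`, mixed products stay in the `T` part and add nothing to it. Exponent 0 must be
excluded: the power is then a single point, the glued set two. -/
theorem gluedSet_pow {G H : Type*} [CommMonoid G] [CommMonoid H] {S : Set G} {T : Set H}
    (hS : 1 ∈ S) (hT : 1 ∈ T) (i : ℕ) :
    gluedSet S T ^ (i + 1) = gluedSet (S ^ (i + 1)) (T ^ (i + 1)) := by
  induction i with
  | zero => simp
  | succ i ih =>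
    have hTi : 1 ∈ T ^ (i + 1) := Set.one_mem_pow hT
    have hST : ∀ t ∈ T, t ∈ T ^ (i + 1 + 1) := fun t ht => by
      rw [pow_succ]; simpa using Set.mul_mem_mul hTi ht
    have hST' : ∀ t ∈ T ^ (i + 1), t ∈ T ^ (i + 1 + 1) := fun t ht => by
      rw [pow_succ]; simpa using Set.mul_mem_mul ht hT
    have hSi : 1 ∈ S ^ (i + 1) := Set.one_mem_pow hS
    rw [pow_succ, ih]
    apply Set.Subset.antisymm
    · rintro _ ⟨_, ⟨x, hx, rfl⟩ | ⟨x, hx, rfl⟩, _, ⟨y, hy, rfl⟩ | ⟨y, hy, rfl⟩, rfl⟩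
      · exact Or.inl ⟨x * y, by rw [pow_succ]; exact Set.mul_mem_mul hx hy, by simp⟩
      · exact Or.inr ⟨y, hST y hy, by simp⟩
      · exact Or.inr ⟨x, hST' x hx, by simp⟩
      · exact Or.inr ⟨x * y, by rw [pow_succ]; exact Set.mul_mem_mul hx hy, by simp⟩
    · rintro _ (⟨x, hx, rfl⟩ | ⟨x, hx, rfl⟩)
      · rw [pow_succ] at hx
        obtain ⟨a, ha, b, hb, rfl⟩ := hx
        exact ⟨_, Or.inl ⟨a, ha, rfl⟩, _, Or.inl ⟨b, hb, rfl⟩, by simp⟩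
      · rw [pow_succ] at hx
        obtain ⟨a, ha, b, hb, rfl⟩ := hx
        exact ⟨_, Or.inr ⟨a, ha, rfl⟩, _, Or.inr ⟨b, hb, rfl⟩, by simp⟩

theorem ncard_gluedSet {G H : Type*} [Monoid G] [Monoid H] {S : Set G} {T : Set H}
    (hS : S.Finite) (hT : T.Finite) : (gluedSet S T).ncard = S.ncard + T.ncard := by
  rw [gluedSet, Set.ncard_union_eq _ (hS.image _) (hT.image _), Set.ncard_image_of_injective,
    Set.ncard_image_of_injective]
  · intro a b h
    simpa using h
  · intro a b h
    simpa using h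
  · rw [Set.disjoint_left]
    rintro _ ⟨x, -, rfl⟩ ⟨y, -, h⟩
    simp at h

theorem finite_pow {G : Type*} [Monoid G] {S : Set G} (hS : S.Finite) (i : ℕ) :
    (S ^ i).Finite := by
  induction i with
  | zero => simp
  | succ i ih => rw [pow_succ]; exact ih.mul hS

theorem IsPowerGrowthPolynomial.add {f g : ℚ[X]} (hf : IsPowerGrowthPolynomial f)
    (hg : IsPowerGrowthPolynomial g) : IsPowerGrowthPolynomial (f + g) := by
  obtain ⟨G, _, S, hS, hS1, m, hm⟩ := hf
  obtain ⟨H, _, T, hT, hT1, l, hl⟩ := hg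
  refine ⟨WithZero G × H, inferInstance, gluedSet S T, (hS.image _).union (hT.image _),
    Or.inl ⟨1, hS1, by simp [Prod.ext_iff]⟩, max m l + 1, fun i hi => ?_⟩
  obtain ⟨i, rfl⟩ : ∃ j, i = j + 1 := ⟨i - 1, by omega⟩
  rw [gluedSet_pow hS1 hT1, ncard_gluedSet (finite_pow hS _) (finite_pow hT _), Nat.cast_add, eval_add,
    hm _ (by omega), hl _ (by omega)]

theorem isPowerGrowthPolynomial_one : IsPowerGrowthPolynomial 1 :=
  ⟨Unit, inferInstance, {1}, Set.finite_singleton _, rfl, 0, fun i _ => by simp⟩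

theorem isPowerGrowthPolynomial_natCast {n : ℕ} (hn : 1 ≤ n) :
    IsPowerGrowthPolynomial (n : ℚ[X]) := by
  induction n, hn using Nat.le_induction with
  | base => simpa using isPowerGrowthPolynomial_one
  | succ n _ ih => simpa using ih.add isPowerGrowthPolynomial_one

theorem pow_zero_one_mul (e i : ℕ) :
    ({1, .ofAdd 1, .ofAdd e} : Set (Multiplicative ℕ)) ^ i =
      {x | ∃ a b : ℕ, a + b ≤ i ∧ x = .ofAdd (a + e * b)} := by
  induction i with
  | zero =>
    ext x
    simp only [pow_zero, Set.mem_one, Set.mem_ofPred_eq]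
    constructor
    · rintro rfl; exact ⟨0, 0, le_rfl, rfl⟩
    · rintro ⟨a, b, h, rfl⟩
      obtain ⟨rfl, rfl⟩ : a = 0 ∧ b = 0 := by omega
      rfl
  | succ i ih =>
    rw [pow_succ, ih]
    ext x
    constructor
    · rintro ⟨_, ⟨a, b, h, rfl⟩, y, rfl | rfl | hy, rfl⟩
      · exact ⟨a, b, by omega, mul_one _⟩
      · exact ⟨a + 1, b, by omega, Multiplicative.toAdd.injective (by simp; ring)⟩
      · rw [Set.mem_singleton_iff.1 hy]
        exact ⟨a, b + 1, by omega, Multiplicative.toAdd.injective (by simp; ring)⟩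
    · rintro ⟨a, b, h, rfl⟩
      rcases a with _ | a
      · rcases b with _ | b
        · exact ⟨1, ⟨0, 0, by omega, rfl⟩, 1, by simp, rfl⟩
        · exact ⟨_, ⟨0, b, by omega, rfl⟩, .ofAdd e, by simp,
            Multiplicative.toAdd.injective (by simp; ring)⟩
      · exact ⟨_, ⟨a, b, by omega, rfl⟩, .ofAdd 1, by simp,
          Multiplicative.toAdd.injective (by simp; ring)⟩

/-- Trading `e` ones for one `e` never lengthens a sum, so each element is `a + e * b` for a unique
pair with `a < e`, subject to `a + b ≤ i`. -/
theorem ncard_pow_zero_one_mul {e : ℕ} (he : 1 ≤ e) (i : ℕ) :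
    (({1, .ofAdd 1, .ofAdd e} : Set (Multiplicative ℕ)) ^ i).ncard =
      ∑ a ∈ Finset.range e, (i + 1 - a) := by
  have h : ({1, .ofAdd 1, .ofAdd e} : Set (Multiplicative ℕ)) ^ i =
      (fun p : (_ : ℕ) × ℕ => Multiplicative.ofAdd (p.1 + e * p.2)) ''
        ((Finset.range e).sigma fun a => Finset.range (i + 1 - a) : Finset _) := by
    rw [pow_zero_one_mul]
    ext x
    simp only [Set.mem_ofPred_eq, Set.mem_image, Finset.mem_coe, Finset.mem_sigma,
      Finset.mem_range]
    constructor
    · rintro ⟨a, b, h, rfl⟩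
      refine ⟨⟨a % e, b + a / e⟩, ⟨Nat.mod_lt _ he, ?_⟩, ?_⟩
      · have h1 := Nat.mod_add_div a e
        have h2 : a / e ≤ e * (a / e) := Nat.le_mul_of_pos_left _ he
        dsimp only
        omega
      · have h1 := Nat.mod_add_div a e
        congr 1
        dsimp only
        rw [mul_add]
        omega
    · rintro ⟨⟨a, b⟩, ⟨h1, h2⟩, rfl⟩
      exact ⟨a, b, by dsimp only at *; omega, rfl⟩
  rw [h, Set.InjOn.ncard_image, Set.ncard_coe_finset, Finset.card_sigma]
  · simp
  · rintro ⟨a, b⟩ hp ⟨c, d⟩ hq hpq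
    simp only [Finset.mem_coe, Finset.mem_sigma, Finset.mem_range] at hp hq
    have hpq' : a + e * b = c + e * d := hpq
    have h1 : a = c := by
      have := congrArg (· % e) hpq'
      simpa [Nat.mod_eq_of_lt hp.1, Nat.mod_eq_of_lt hq.1] using this
    subst h1
    have h2 : b = d := Nat.eq_of_mul_eq_mul_left he (by omega)
    rw [h2]

/-- The Hilbert polynomial of a plane curve of degree `e`. -/
noncomputable def planeCurvePolynomial (e : ℚ) : ℚ[X] := C e * (X + 1) - C (e * (e - 1) / 2)

theorem isPowerGrowthPolynomial_planeCurve {e : ℕ} (he : 1 ≤ e) :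
    IsPowerGrowthPolynomial (planeCurvePolynomial e) := by
  refine ⟨Multiplicative ℕ, inferInstance, {1, .ofAdd 1, .ofAdd e}, by simp, by simp, e,
    fun i hi => ?_⟩
  rw [ncard_pow_zero_one_mul he]
  -- For `j ≤ i` the natural subtraction never truncates.
  have h : ∀ j ≤ i, ((∑ a ∈ Finset.range j, (i + 1 - a) : ℕ) : ℚ) =
      j * (i + 1) - j * (j - 1) / 2 := by
    intro j
    induction j with
    | zero => simp
    | succ j ih =>
      intro hj
      rw [Finset.sum_range_succ, Nat.cast_add, ih (by omega), Nat.cast_sub (by omega)]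
      push_cast
      ring
  rw [h e hi, planeCurvePolynomial]
  simp

theorem isPowerGrowthPolynomial_pow_mul_planeCurve {e : ℕ} (he : 1 ≤ e) (j : ℕ) :
    IsPowerGrowthPolynomial ((X + 1) ^ j * planeCurvePolynomial e) := by
  induction j with
  | zero => simpa using isPowerGrowthPolynomial_planeCurve he
  | succ j ih =>
    have h : IsPowerGrowthPolynomial (X + 1) := by
      simpa [planeCurvePolynomial] using isPowerGrowthPolynomial_planeCurve (e := 1) le_rfl
    rw [pow_succ', mul_assoc]
    exact h.mul ih

end Growth

/-! ### Induction on the degree -/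

theorem two_mul_ediv_mul_sub_one (n : ℤ) : 2 * (n * (n - 1) / 2) = n * (n - 1) :=
  Int.mul_ediv_cancel' (even_iff_two_dvd.1 (Int.even_mul_pred_self n))

theorem add_one_pow_eq_sum (d : ℕ) :
    (X + 1 : ℚ[X]) ^ d = X ^ d + ∑ i : Fin d, C (d.choose i : ℚ) * X ^ (i : ℕ) := by
  rw [add_pow, Finset.sum_range_succ, Fin.sum_univ_eq_sum_range
    (fun i => C (d.choose i : ℚ) * X ^ i)]
  simp [mul_comm, add_comm]

/-- Splitting off `(x + 1) ^ d` times the polynomial of a plane curve of degree `n`. -/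
theorem leading_term_split (d : ℕ) (n : ℤ) (a : Fin (d + 1) → ℤ) :
    C (n : ℚ) * X ^ (d + 1) + ∑ i : Fin (d + 1), C (a i : ℚ) * X ^ (i : ℕ) =
      (X + 1) ^ d * planeCurvePolynomial n +
      (C ((a (Fin.last d) + n * (n - 1) / 2 - n * (d + 1) : ℤ) : ℚ) * X ^ d +
        ∑ i : Fin d, C ((a i.castSucc + n * (n - 1) / 2 * d.choose i - n * (d + 1).choose i : ℤ) : ℚ)
          * X ^ (i : ℕ)) := by
  have hn : ((n * (n - 1) / 2 : ℤ) : ℚ) = n * (n - 1) / 2 := by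
    have := two_mul_ediv_mul_sub_one n
    rw [eq_div_iff two_ne_zero, mul_comm]
    exact_mod_cast this
  have h1 := add_one_pow_eq_sum (d + 1)
  have h2 := add_one_pow_eq_sum d
  rw [Fin.sum_univ_castSucc] at h1
  rw [Fin.sum_univ_castSucc]
  have h3 : (X + 1 : ℚ[X]) ^ d * planeCurvePolynomial n =
      C (n : ℚ) * (X + 1) ^ (d + 1) - C ((n * (n - 1) / 2 : ℤ) : ℚ) * (X + 1) ^ d := by
    rw [planeCurvePolynomial, hn]
    ring
  rw [h3, h1, h2]
  have h4 : ∀ i : Fin d,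
      C ((a i.castSucc + n * (n - 1) / 2 * d.choose i - n * (d + 1).choose i : ℤ) : ℚ) *
        X ^ (i : ℕ) = C (a i.castSucc : ℚ) * X ^ (i : ℕ) +
        C ((n * (n - 1) / 2 : ℤ) : ℚ) * (C (d.choose i : ℚ) * X ^ (i : ℕ)) -
        C (n : ℚ) * (C ((d + 1).choose i : ℚ) * X ^ (i : ℕ)) := by
    intro i
    simp only [Int.cast_sub, Int.cast_add, Int.cast_mul, C_add, C_sub, C_mul, Int.cast_natCast]
    ring
  simp only [h4, Finset.sum_add_distrib, Finset.sum_sub_distrib, ← Finset.mul_sum]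
  simp only [Fin.val_castSucc, Fin.val_last, Nat.choose_succ_self_right, Int.cast_sub,
    Int.cast_add, Int.cast_mul, C_add, C_sub, C_mul, Int.cast_natCast, Nat.cast_add, Nat.cast_one,
    Int.cast_one]
  ring

/-- The right side is `(d + 1 - i)` times the left, and that factor is at least 1. -/
theorem choose_succ_le_mul {d i : ℕ} (hi : i ≤ d) :
    (d + 1).choose i ≤ (d + 1) * d.choose i := by
  have h := Nat.choose_mul_succ_eq d i
  calc (d + 1).choose i ≤ (d + 1).choose i * (d + 1 - i) := Nat.le_mul_of_pos_right _ (by omega)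
    _ = (d + 1) * d.choose i := by rw [← h, mul_comm]

/-- Lower bounds on the coefficients make a polynomial a power growth polynomial. -/
theorem isPowerGrowthPolynomial_of_le (N : ℤ) (d : ℕ) :
    ∀ (n : ℤ) (a : Fin d → ℤ), (∀ i, N ≤ a i) → 2 * (d : ℤ) + 5 ≤ n → 0 ≤ n + N →
      IsPowerGrowthPolynomial
        (C (n : ℚ) * X ^ d + ∑ i : Fin d, C (a i : ℚ) * X ^ (i : ℕ)) := by
  induction d with
  | zero =>
    intro n a _ hn _
    lift n to ℕ using by omega
    simpa using isPowerGrowthPolynomial_natCast (n := n) (by omega)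
  | succ d ih =>
    intro n a ha hn hN
    push_cast at hn
    have h2 := two_mul_ediv_mul_sub_one n
    set q := n * (n - 1) / 2
    -- Equivalent to `n ≥ 2 * d + 7`, the hypothesis in degree `d + 1`. The spare `2 * n` makes the
    -- new leading coefficient at least `2 * n + N ≥ n`.
    have hq : n * (d + 1) + 2 * n ≤ q := by nlinarith
    rw [leading_term_split]
    apply IsPowerGrowthPolynomial.add
    · lift n to ℕ using by omega
      exact_mod_cast isPowerGrowthPolynomial_pow_mul_planeCurve (e := n) (by omega) d
    · have hl := ha (Fin.last d)
      apply ih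
      · intro i
        have hc : ((d + 1).choose i : ℤ) ≤ (d + 1) * d.choose i := by
          exact_mod_cast choose_succ_le_mul i.2.le
        have h3 : n * ((d + 1).choose i : ℤ) ≤ q * d.choose i :=
          calc n * ((d + 1).choose i : ℤ) ≤ n * ((d + 1) * d.choose i) :=
                mul_le_mul_of_nonneg_left hc (by omega)
            _ = n * (d + 1) * d.choose i := by ring
            _ ≤ q * d.choose i := mul_le_mul_of_nonneg_right (by omega) (by positivity)
        linarith [ha i.castSucc]
      · linarith
      · linarith

theorem mainTheorem1 (k : Type u) [Field k] (d : ℕ) (hd : 1 ≤ d) (a : Fin d → ℤ)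
    (N : ℤ) (hN : IsLeast (Set.range a) N) :
    (-2 ≤ N → ∀ n : ℤ, 5 * (d : ℤ) + 3 ≤ n →
      IsHilbertPolynomial k
        (C (n : ℚ) * X ^ d + ∑ i : Fin d, C (a i : ℚ) * X ^ (i : ℕ))) ∧
    (N < -2 → ∀ n : ℤ, -10 * (d : ℤ) * ⌊(N : ℚ) / 5⌋ + 3 ≤ n →
      IsHilbertPolynomial k
        (C (n : ℚ) * X ^ d + ∑ i : Fin d, C (a i : ℚ) * X ^ (i : ℕ))) := by
  have ha : ∀ i, N ≤ a i := fun i => hN.2 ⟨i, rfl⟩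
  constructor
  · intro h n hn
    exact (isPowerGrowthPolynomial_of_le N d n a ha (by omega) (by omega)).isHilbertPolynomial k
  · intro h n hn
    have hfl : ⌊(N : ℚ) / 5⌋ = N / 5 := by
      simpa using Rat.floor_intCast_div_natCast N 5
    rw [hfl] at hn
    have hK : 1 ≤ -(N / 5) := by omega
    have hd' : (1 : ℤ) ≤ d := by exact_mod_cast hd
    have h1 : (d : ℤ) ≤ d * -(N / 5) := le_mul_of_one_le_right (by omega) hK
    have h2 : -(N / 5) ≤ d * -(N / 5) := le_mul_of_one_le_left (by omega) hd'
    have h3 : 10 * (d * -(N / 5)) + 3 ≤ n := by linarith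
    exact (isPowerGrowthPolynomial_of_le N d n a ha (by omega) (by omega)).isHilbertPolynomial k
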